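/- Let $d\in\mathbb N=\{1,2,\dots\}$, $T\in(0,\infty)$, let $u,h\in C([0,T]\times\mathbb R^d,\mathbb R)$, let $(\Omega,\mathcal F,\mathbb P)$ be a probability space, and let $W\colon[0,T]\times\Omega\to\mathbb R^d$ be a standard Brownian motion. For every $t\in[0,T]$, $s\in[t,T]$, $x\in\mathbb R^d$ let $X_{t,s,x}=x+W_s-W_t$. Assume that $u$ is bounded on $[0,T]\times\mathbb R^d$, that $u|_{[0,T)\times\mathbb R^d}\in C^{1,2}([0,T)\times\mathbb R^d,\mathbb R)$ (with a one-sided time derivative at $t=0$), and that for every $t\in[0,T)$, $x\in\mathbb R^d$ it holds that $$\mathbb E\Big[\int_t^T|h(s,X_{t,s,x})|\,ds\Big]<\infty\qquad\text{and}\qquad \big(\tfrac{\partial}{\partial t}u\big)(t,x)+\tfrac12(\Delta_xu)(t,x)+h(t,x)=0.$$ Then for every $t\in[0,T]$, $x\in\mathbb R^d$ the random variable $u(T,X_{t,T,x})+\int_t^Th(s,X_{t,s,x})\,ds$ is integrable and $$u(t,x)=\mathbb E\Big[u(T,X_{t,T,x})+\int_t^Th(s,X_{t,s,x})\,ds\Big].$$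 -/

import Mathlib

open MeasureTheory ProbabilityTheory Set

/-- `W` is a `d`-dimensional standard Brownian motion on the time interval `[0, T]`, under the
measure `P`: it starts at `0`, has independent Gaussian increments
`W t - W s ∼ N(0, (t - s) I_d)`, and has almost surely continuous paths.
The values of `W` at times outside `[0, T]` are irrelevant. -/
structure IsStandardBrownianOn {d : ℕ} {Ω : Type*} [MeasurableSpace Ω] (T : ℝ)
    (W : ℝ → Ω → EuclideanSpace ℝ (Fin d)) (P : Measure Ω) : Prop where
  zero : ∀ᵐ ω ∂P, W 0 ω = 0
  aemeasurable : ∀ t ∈ Icc 0 T, AEMeasurable (W t) P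
  indep_increments : HasIndepIncrements (fun t : Icc (0 : ℝ) T => W t) P
  gaussian_increments : ∀ s t : ℝ, 0 ≤ s → s ≤ t → t ≤ T →
    HasLaw (fun ω => W t ω - W s ω)
      (multivariateGaussian 0 ((t - s) • (1 : Matrix (Fin d) (Fin d) ℝ))) P
  continuous_paths : ∀ᵐ ω ∂P, ContinuousOn (fun t => W t ω) (Icc 0 T)

/-- `u` is of class `C^{1,2}` on `[0, T) × ℝ^d`: it is once differentiable in time (one-sidedly at
time `0`) and twice differentiable in space, and `u`, `∂_t u`, `D_x u`, `D_x² u` are jointly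
continuous on `[0, T) × ℝ^d`. -/
structure IsC12On {d : ℕ} (T : ℝ) (u : ℝ → EuclideanSpace ℝ (Fin d) → ℝ) : Prop where
  continuousOn : ContinuousOn (fun p : ℝ × EuclideanSpace ℝ (Fin d) => u p.1 p.2)
    (Ico 0 T ×ˢ univ)
  differentiableOn_time : ∀ x, DifferentiableOn ℝ (fun t => u t x) (Ico 0 T)
  contDiff_space : ∀ t ∈ Ico 0 T, ContDiff ℝ 2 (u t)
  continuousOn_time_deriv : ContinuousOn
    (fun p : ℝ × EuclideanSpace ℝ (Fin d) => derivWithin (fun t => u t p.2) (Ico 0 T) p.1)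
    (Ico 0 T ×ˢ univ)
  continuousOn_space_fderiv : ContinuousOn
    (fun p : ℝ × EuclideanSpace ℝ (Fin d) => fderiv ℝ (u p.1) p.2) (Ico 0 T ×ˢ univ)
  continuousOn_space_fderiv_two : ContinuousOn
    (fun p : ℝ × EuclideanSpace ℝ (Fin d) => iteratedFDeriv ℝ 2 (u p.1) p.2) (Ico 0 T ×ˢ univ)

/-! For `t < T` the substitution `s = t + r²` turns `X_{t,s,x}` into a variable with the law of `x +
rZ`, `Z` standard Gaussian, so the claim becomes calculus in the single variable `r`. The curve `r ↦
(t + r², x + rz)` is smooth, which avoids the singularity of `√(s - t)` at `s = t`, and no Itô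
formula is needed.

Since `u` has no bounds on its derivatives, it is multiplied by a cutoff `φ`. The function `F(r) =
E[φ(x + rZ) u(t + r², x + rZ)]` is differentiated under the integral
(`IsC12On.hasDerivAt_integral`). Gaussian integration by parts
(`integral_fderiv_mul_stdGaussian_comp`) turns the derivative in direction `Z` into `r E[φ Δu]` plus
errors containing `u`, `∇φ` and `Δφ` but not `∇u`. The equation then replaces the main terms by `-2r
E[φ h]`.

The mean value theorem bounds the defect in the cutoff Duhamel formula by the sup norms of `u`, `∇φ`
and `Δφ` (`IsC12On.abs_duhamel_cutoff_le`). Along cutoffs exhausting the space this bound tends to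
zero, while dominated convergence restores the full formula: `u` is bounded and `h` is integrable
for `ds ⊗ P`. -/

open Filter Topology

/-! ### Gaussian integration by parts -/

section GaussianIntegrationByParts

open scoped RealInnerProductSpace

variable {E : Type*} [NormedAddCommGroup E] [InnerProductSpace ℝ E]

theorem HasCompactSupport.comp_add_smul {F : Type*} [Zero F] {g : E → F} (hc : HasCompactSupport g)
    (x : E) {r : ℝ} (hr : r ≠ 0) : HasCompactSupport fun z => g (x + r • z) :=
  hc.comp_homeomorph ((Homeomorph.smulOfNeZero r hr).trans (Homeomorph.addLeft x))

variable [FiniteDimensional ℝ E]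

theorem laplacian_eq_sum_fderiv_fderiv {f : E → ℝ} (hf : ContDiff ℝ 2 f) (y : E) :
    Laplacian.laplacian f y = ∑ i, fderiv ℝ (fun y => fderiv ℝ f y (stdOrthonormalBasis ℝ E i)) y
      (stdOrthonormalBasis ℝ E i) := by
  rw [InnerProductSpace.laplacian_eq_iteratedFDeriv_stdOrthonormalBasis]
  refine Finset.sum_congr rfl fun i _ => ?_
  rw [iteratedFDeriv_two_apply]
  have h1 : DifferentiableAt ℝ (fderiv ℝ f) y :=
    (hf.fderiv_right (m := 1) (by norm_num)).differentiable one_ne_zero y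
  rw [fderiv_clm_apply h1 (by fun_prop)]
  simp

theorem continuous_laplacian {f : E → ℝ} (hf : ContDiff ℝ 2 f) :
    Continuous (Laplacian.laplacian f) := by
  rw [InnerProductSpace.laplacian_eq_iteratedFDeriv_stdOrthonormalBasis]
  have := hf.continuous_iteratedFDeriv (m := 2) le_rfl
  fun_prop

theorem HasCompactSupport.laplacian {f : E → ℝ} (hf : HasCompactSupport f) :
    HasCompactSupport (Laplacian.laplacian f) := by
  refine (hf.iteratedFDeriv (𝕜 := ℝ) 2).mono fun x hx => ?_
  contrapose! hx
  simp only [Function.mem_support, ne_eq, not_not] at hx ⊢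
  simp [InnerProductSpace.laplacian_eq_iteratedFDeriv_stdOrthonormalBasis, hx]

variable [MeasurableSpace E] [BorelSpace E]

/-- Both sides are finite measures, and the Gaussian Fourier integral shows that their
characteristic functions agree. The density makes Lebesgue integration by parts available. -/
theorem stdGaussian_eq_withDensity :
    stdGaussian E = volume.withDensity (fun x : E => ENNReal.ofReal
      (((2 * Real.pi) ^ (Module.finrank ℝ E / 2 : ℝ))⁻¹ * Real.exp (-(1 / 2) * ‖x‖ ^ 2))) := by
  set c : ℝ := ((2 * Real.pi) ^ (Module.finrank ℝ E / 2 : ℝ))⁻¹ with hc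
  have hc0 : 0 < c := by positivity
  have hint : Integrable (fun x : E => Real.exp (-(1 / 2) * ‖x‖ ^ 2)) := by
    -- A non-integrable function would have Bochner integral `0`, but the Gaussian integral has a
    -- positive value.
    by_contra h
    have h1 := GaussianFourier.integral_rexp_neg_mul_sq_norm (V := E) (b := 1 / 2) (by norm_num)
    rw [integral_undef h] at h1
    have : (0 : ℝ) < (Real.pi / (1 / 2)) ^ (Module.finrank ℝ E / 2 : ℝ) := by positivity
    linarith
  have : IsFiniteMeasure (volume.withDensity (fun x : E => ENNReal.ofReal
      (c * Real.exp (-(1 / 2) * ‖x‖ ^ 2)))) :=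
    isFiniteMeasure_withDensity_ofReal (hint.const_mul c).hasFiniteIntegral
  refine Measure.ext_of_charFun (funext fun t => ?_)
  rw [charFun_stdGaussian, charFun_apply, integral_withDensity_eq_integral_toReal_smul
    (by fun_prop) (by simp)]
  have key := GaussianFourier.integral_cexp_neg_mul_sq_norm_add (V := E) (b := 1 / 2)
    (by norm_num) Complex.I t
  have : ∀ x : E, (ENNReal.ofReal (c * Real.exp (-(1 / 2) * ‖x‖ ^ 2))).toReal •
      Complex.exp (⟪x, t⟫ * Complex.I)
      = (c : ℂ) * Complex.exp (-(1 / 2) * ‖x‖ ^ 2 + Complex.I * ⟪t, x⟫) := by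
    intro x
    rw [ENNReal.toReal_ofReal (by positivity), Complex.exp_add, real_inner_comm]
    simp [mul_comm, mul_assoc]
  simp_rw [this]
  rw [integral_const_mul, key, ← mul_assoc]
  have h2 : (c : ℂ) * (Real.pi / (1 / 2)) ^ (Module.finrank ℝ E / 2 : ℂ) = 1 := by
    have : (Real.pi / (1 / 2) : ℂ) = ((2 * Real.pi : ℝ) : ℂ) := by push_cast; ring
    rw [this, hc, show (Module.finrank ℝ E / 2 : ℂ) = ((Module.finrank ℝ E / 2 : ℝ) : ℂ) by
      push_cast; rfl, ← Complex.ofReal_cpow (by positivity), ← Complex.ofReal_mul,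
      inv_mul_cancel₀ (by positivity), Complex.ofReal_one]
  rw [h2, one_mul, Complex.I_sq]
  congr 1
  ring

theorem integral_stdGaussian_eq (f : E → ℝ) :
    ∫ x, f x ∂stdGaussian E = ((2 * Real.pi) ^ (Module.finrank ℝ E / 2 : ℝ))⁻¹ *
      ∫ x, Real.exp (-(1 / 2) * ‖x‖ ^ 2) * f x := by
  rw [stdGaussian_eq_withDensity, integral_withDensity_eq_integral_toReal_smul
    (by fun_prop) (by simp), ← integral_const_mul]
  refine integral_congr_ae (ae_of_all _ fun x => ?_)
  simp only [smul_eq_mul]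
  rw [ENNReal.toReal_ofReal (by positivity), mul_assoc]

/-- Stein's identity for the standard Gaussian measure. -/
theorem integral_fderiv_stdGaussian {f : E → ℝ} (hf : ContDiff ℝ 1 f) (hc : HasCompactSupport f)
    (v : E) : ∫ x, fderiv ℝ f x v ∂stdGaussian E = ∫ x, ⟪v, x⟫ * f x ∂stdGaussian E := by
  set ρ : E → ℝ := fun x => Real.exp (-(1 / 2) * ‖x‖ ^ 2) with hρ
  have hρd : ∀ x, HasFDerivAt ρ (ρ x • (-(1 / 2) : ℝ) • (2 : ℝ) • innerSL ℝ x) x := fun x =>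
    (((hasStrictFDerivAt_norm_sq x).hasFDerivAt.const_mul (-(1 / 2) : ℝ)).exp.congr_fderiv
      (by ext; simp [hρ]))
  -- The logarithmic derivative of the Gaussian density produces the weight `⟪v, x⟫` in Stein's
  -- identity.
  have hρ' : ∀ x, fderiv ℝ ρ x v = - (ρ x * ⟪v, x⟫) := fun x => by
    rw [(hρd x).fderiv]; simp [real_inner_comm]
  have hρc : Continuous ρ := by fun_prop
  rw [integral_stdGaussian_eq, integral_stdGaussian_eq]
  congr 1
  change ∫ x, ρ x * fderiv ℝ f x v = ∫ x, ρ x * (⟪v, x⟫ * f x)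
  have hdf : Continuous fun x => fderiv ℝ f x v :=
    (hf.continuous_fderiv one_ne_zero).clm_apply continuous_const
  rw [integral_mul_fderiv_eq_neg_fderiv_mul_of_integrable, ← integral_neg]
  · refine integral_congr_ae (ae_of_all _ fun x => ?_)
    simp only [hρ']
    ring
  · simp_rw [hρ']
    exact Continuous.integrable_of_hasCompactSupport
      (by have := hf.continuous; fun_prop) hc.mul_left
  · exact Continuous.integrable_of_hasCompactSupport (by fun_prop)
      ((hc.fderiv_apply (𝕜 := ℝ) v).mul_left)
  · exact Continuous.integrable_of_hasCompactSupport
      (by have := hf.continuous; fun_prop) hc.mul_left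
  · exact fun x _ => (hρd x).differentiableAt
  · exact fun x _ => hf.differentiable one_ne_zero x

theorem integral_fderiv_stdGaussian_comp {g : E → ℝ} (hg : ContDiff ℝ 1 g)
    (hc : HasCompactSupport g) (x : E) {r : ℝ} (hr : r ≠ 0) (v : E) :
    ∫ z, ⟪v, z⟫ * g (x + r • z) ∂stdGaussian E =
      r * ∫ z, fderiv ℝ g (x + r • z) v ∂stdGaussian E := by
  rw [← integral_fderiv_stdGaussian (f := fun z => g (x + r • z)) (hg.comp (by fun_prop))
    (hc.comp_add_smul x hr) v, ← integral_const_mul]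
  refine integral_congr_ae (ae_of_all _ fun z => ?_)
  have h1 : HasFDerivAt (fun z : E => x + r • z) (r • ContinuousLinearMap.id ℝ E) z :=
    ((hasFDerivAt_id z).const_smul r).const_add x
  have h2 := ((hg.differentiable one_ne_zero (x + r • z)).hasFDerivAt).comp z h1
  have : fderiv ℝ (fun z => g (x + r • z)) z = _ := h2.fderiv
  simp [this]

theorem Continuous.integrable_stdGaussian_comp {g : E → ℝ} (hg : Continuous g)
    (hc : HasCompactSupport g) (x : E) {r : ℝ} (hr : r ≠ 0) :
    Integrable (fun z => g (x + r • z)) (stdGaussian E) :=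
  Continuous.integrable_of_hasCompactSupport (by fun_prop) (hc.comp_add_smul x hr)

/-- Stein's identity applied to `φ ∂ᵢf` and to `f ∂ᵢφ` gives the same cross term `r E[∂ᵢφ ∂ᵢf]`.
Eliminating it leaves an expression in which `f` is differentiated only under the factor `φ`, so the
error terms are controlled by a bound on `f` alone. -/
theorem integral_fderiv_mul_stdGaussian_comp {f φ : E → ℝ} (hf : ContDiff ℝ 2 f)
    (hφ : ContDiff ℝ 2 φ) (hc : HasCompactSupport φ) (x : E) {r : ℝ} (hr : r ≠ 0) :
    ∫ z, fderiv ℝ (fun y => φ y * f y) (x + r • z) z ∂stdGaussian E =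
      r * ∫ z, φ (x + r • z) * Laplacian.laplacian f (x + r • z) ∂stdGaussian E
      + 2 * ∫ z, f (x + r • z) * fderiv ℝ φ (x + r • z) z ∂stdGaussian E
      - r * ∫ z, f (x + r • z) * Laplacian.laplacian φ (x + r • z) ∂stdGaussian E := by
  set b := stdOrthonormalBasis ℝ E with hb
  have hfc := hf.continuous
  have hφc := hφ.continuous
  have hf1 : ∀ i, ContDiff ℝ 1 fun y => fderiv ℝ f y (b i) := fun i =>
    (hf.fderiv_right (m := 1) (by norm_num)).clm_apply contDiff_const
  have hφ1 : ∀ i, ContDiff ℝ 1 fun y => fderiv ℝ φ y (b i) := fun i =>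
    (hφ.fderiv_right (m := 1) (by norm_num)).clm_apply contDiff_const
  have hcφ1 : ∀ i, HasCompactSupport fun y => fderiv ℝ φ y (b i) := fun i =>
    hc.fderiv_apply (𝕜 := ℝ) (b i)
  have hf2 : ∀ i, Continuous fun y => fderiv ℝ (fun y => fderiv ℝ f y (b i)) y (b i) := fun i =>
    ((hf1 i).continuous_fderiv one_ne_zero).clm_apply continuous_const
  have hφ2 : ∀ i, Continuous fun y => fderiv ℝ (fun y => fderiv ℝ φ y (b i)) y (b i) := fun i =>
    ((hφ1 i).continuous_fderiv one_ne_zero).clm_apply continuous_const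
  have hcφ2 : ∀ i, HasCompactSupport fun y => fderiv ℝ (fun y => fderiv ℝ φ y (b i)) y (b i) :=
    fun i => (hcφ1 i).fderiv_apply (𝕜 := ℝ) (b i)
  have hf1c := fun i => (hf1 i).continuous
  have hφ1c := fun i => (hφ1 i).continuous
  have hfd : Differentiable ℝ f := hf.differentiable two_ne_zero
  have hφd : Differentiable ℝ φ := hφ.differentiable two_ne_zero
  -- expand along the basis
  have hexp : ∀ (L : E →L[ℝ] ℝ) (z : E), L z = ∑ i, ⟪b i, z⟫ * L (b i) := fun L z => by
    conv_lhs => rw [← b.sum_repr' z]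
    simp
  -- Stein's identity for the two products
  have S1 : ∀ i, ∫ z, ⟪b i, z⟫ * (φ (x + r • z) * fderiv ℝ f (x + r • z) (b i)) ∂stdGaussian E
      = r * ∫ z, fderiv ℝ φ (x + r • z) (b i) * fderiv ℝ f (x + r • z) (b i) ∂stdGaussian E
      + r * ∫ z, φ (x + r • z) *
        fderiv ℝ (fun y => fderiv ℝ f y (b i)) (x + r • z) (b i) ∂stdGaussian E := fun i => by
    have := integral_fderiv_stdGaussian_comp (g := fun y => φ y * fderiv ℝ f y (b i))
      ((hφ.of_le (by norm_num)).mul (hf1 i)) hc.mul_right x hr (b i)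
    rw [this, ← mul_add, ← integral_add]
    · congr 1
      refine integral_congr_ae (ae_of_all _ fun z => ?_)
      simp only
      rw [fderiv_fun_mul (hφd _) ((hf1 i).differentiable one_ne_zero _)]
      simp only [add_apply, smul_apply, smul_eq_mul]
      ring
    · exact Continuous.integrable_stdGaussian_comp
        (g := fun y => fderiv ℝ φ y (b i) * fderiv ℝ f y (b i))
        ((hφ1c i).mul (hf1c i)) (hcφ1 i).mul_right x hr
    · exact Continuous.integrable_stdGaussian_comp
        (g := fun y => φ y * fderiv ℝ (fun y => fderiv ℝ f y (b i)) y (b i))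
        (hφc.mul (hf2 i)) hc.mul_right x hr
  have S2 : ∀ i, ∫ z, ⟪b i, z⟫ * (f (x + r • z) * fderiv ℝ φ (x + r • z) (b i)) ∂stdGaussian E
      = r * ∫ z, fderiv ℝ φ (x + r • z) (b i) * fderiv ℝ f (x + r • z) (b i) ∂stdGaussian E
      + r * ∫ z, f (x + r • z) *
        fderiv ℝ (fun y => fderiv ℝ φ y (b i)) (x + r • z) (b i) ∂stdGaussian E := fun i => by
    have := integral_fderiv_stdGaussian_comp (g := fun y => f y * fderiv ℝ φ y (b i))
      ((hf.of_le (by norm_num)).mul (hφ1 i)) (hcφ1 i).mul_left x hr (b i)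
    rw [this, ← mul_add, ← integral_add]
    · congr 1
      refine integral_congr_ae (ae_of_all _ fun z => ?_)
      simp only
      rw [fderiv_fun_mul (hfd _) ((hφ1 i).differentiable one_ne_zero _)]
      simp only [add_apply, smul_apply, smul_eq_mul]
      ring
    · exact Continuous.integrable_stdGaussian_comp
        (g := fun y => fderiv ℝ φ y (b i) * fderiv ℝ f y (b i))
        ((hφ1c i).mul (hf1c i)) (hcφ1 i).mul_right x hr
    · exact Continuous.integrable_stdGaussian_comp
        (g := fun y => f y * fderiv ℝ (fun y => fderiv ℝ φ y (b i)) y (b i))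
        (hfc.mul (hφ2 i)) (hcφ2 i).mul_left x hr
  have I1 : ∀ i, Integrable (fun z => ⟪b i, z⟫ * (φ (x + r • z) * fderiv ℝ f (x + r • z) (b i)))
      (stdGaussian E) := fun i =>
    Continuous.integrable_of_hasCompactSupport (by fun_prop)
      ((hc.comp_add_smul x hr).mul_right.mul_left)
  have I2 : ∀ i, Integrable (fun z => ⟪b i, z⟫ * (f (x + r • z) * fderiv ℝ φ (x + r • z) (b i)))
      (stdGaussian E) := fun i =>
    Continuous.integrable_of_hasCompactSupport (by fun_prop)
      (((hcφ1 i).comp_add_smul x hr).mul_left.mul_left)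
  have E1 : ∫ z, fderiv ℝ (fun y => φ y * f y) (x + r • z) z ∂stdGaussian E =
      ∑ i, (∫ z, ⟪b i, z⟫ * (φ (x + r • z) * fderiv ℝ f (x + r • z) (b i)) ∂stdGaussian E
        + ∫ z, ⟪b i, z⟫ * (f (x + r • z) * fderiv ℝ φ (x + r • z) (b i)) ∂stdGaussian E) := by
    simp_rw [← fun i => integral_add (I1 i) (I2 i)]
    rw [← integral_finsetSum (f := fun i z => ⟪b i, z⟫ * (φ (x + r • z) *
      fderiv ℝ f (x + r • z) (b i)) + ⟪b i, z⟫ * (f (x + r • z) * fderiv ℝ φ (x + r • z) (b i)))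
      _ fun i _ => (I1 i).add (I2 i)]
    refine integral_congr_ae (ae_of_all _ fun z => ?_)
    simp only
    rw [hexp, fderiv_fun_mul (hφd _) (hfd _)]
    refine Finset.sum_congr rfl fun i _ => ?_
    simp only [add_apply, smul_apply, smul_eq_mul]
    ring
  have E2 : ∫ z, f (x + r • z) * fderiv ℝ φ (x + r • z) z ∂stdGaussian E =
      ∑ i, ∫ z, ⟪b i, z⟫ * (f (x + r • z) * fderiv ℝ φ (x + r • z) (b i)) ∂stdGaussian E := by
    rw [← integral_finsetSum _ fun i _ => I2 i]
    refine integral_congr_ae (ae_of_all _ fun z => ?_)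
    simp only
    rw [hexp, Finset.mul_sum]
    refine Finset.sum_congr rfl fun i _ => ?_
    ring
  have E3 : ∫ z, φ (x + r • z) * Laplacian.laplacian f (x + r • z) ∂stdGaussian E =
      ∑ i, ∫ z, φ (x + r • z) *
        fderiv ℝ (fun y => fderiv ℝ f y (b i)) (x + r • z) (b i) ∂stdGaussian E := by
    rw [← integral_finsetSum]
    · simp_rw [laplacian_eq_sum_fderiv_fderiv hf, Finset.mul_sum]
      rfl
    · exact fun i _ => Continuous.integrable_stdGaussian_comp
        (g := fun y => φ y * fderiv ℝ (fun y => fderiv ℝ f y (b i)) y (b i))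
        (hφc.mul (hf2 i)) hc.mul_right x hr
  have E4 : ∫ z, f (x + r • z) * Laplacian.laplacian φ (x + r • z) ∂stdGaussian E =
      ∑ i, ∫ z, f (x + r • z) *
        fderiv ℝ (fun y => fderiv ℝ φ y (b i)) (x + r • z) (b i) ∂stdGaussian E := by
    rw [← integral_finsetSum]
    · simp_rw [laplacian_eq_sum_fderiv_fderiv hφ, Finset.mul_sum]
      rfl
    · exact fun i _ => Continuous.integrable_stdGaussian_comp
        (g := fun y => f y * fderiv ℝ (fun y => fderiv ℝ φ y (b i)) y (b i))
        (hfc.mul (hφ2 i)) (hcφ2 i).mul_left x hr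
  rw [E1, E2, E3, E4, Finset.mul_sum, Finset.mul_sum, Finset.mul_sum, ← Finset.sum_add_distrib,
    ← Finset.sum_sub_distrib]
  refine Finset.sum_congr rfl fun i _ => ?_
  rw [S1, S2]
  ring

end GaussianIntegrationByParts

/-! ### Cutoff functions -/

section Cutoff

variable {E : Type*} [NormedAddCommGroup E] [InnerProductSpace ℝ E] [FiniteDimensional ℝ E]

theorem laplacian_comp_smul {f : E → ℝ} (hf : ContDiff ℝ 2 f) (c : ℝ) (y : E) :
    Laplacian.laplacian (fun y => f (c • y)) y = c ^ 2 * Laplacian.laplacian f (c • y) := by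
  rw [laplacian_eq_sum_fderiv_fderiv (f := fun y => f (c • y)) (hf.comp (by fun_prop : ContDiff ℝ 2 fun y : E => c • y)),
    laplacian_eq_sum_fderiv_fderiv hf, Finset.mul_sum]
  refine Finset.sum_congr rfl fun i _ => ?_
  set e := stdOrthonormalBasis ℝ E i
  have h1 : (fun y => fderiv ℝ (fun y => f (c • y)) y e) = fun y => c * fderiv ℝ f (c • y) e := by
    funext y
    rw [fderiv_comp_smul c (f := f)]
    simp
  have hd : Differentiable ℝ fun y => fderiv ℝ f y e :=
    ((hf.fderiv_right (m := 1) (by norm_num)).clm_apply contDiff_const).differentiable one_ne_zero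
  have hd' : Differentiable ℝ fun y => fderiv ℝ f (c • y) e :=
    hd.comp (by fun_prop : Differentiable ℝ fun y : E => c • y)
  rw [h1, fderiv_const_mul (hd' y),
    fderiv_comp_smul c (f := fun y => fderiv ℝ f y e)]
  simp only [smul_apply, smul_eq_mul]
  ring

/-- A sequence of compactly supported cutoff functions which exhausts the space and whose gradients
and Laplacians tend to zero uniformly. -/
theorem exists_cutoff_sequence : ∃ (φ : ℕ → E → ℝ) (K : ℝ), ∀ n, ContDiff ℝ 2 (φ n) ∧
    HasCompactSupport (φ n) ∧ (∀ y, |φ n y| ≤ 1) ∧ (∀ y, ‖y‖ ≤ n → φ n y = 1) ∧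
    (∀ y, ‖fderiv ℝ (φ n) y‖ ≤ K / (n + 1)) ∧
    ∀ y, |Laplacian.laplacian (φ n) y| ≤ K / (n + 1) := by
  let f : ContDiffBump (0 : E) := ⟨1, 2, by norm_num, by norm_num⟩
  have hf : ContDiff ℝ 2 f := f.contDiff
  have hc : HasCompactSupport f := f.hasCompactSupport
  obtain ⟨K₁, hK₁⟩ := (hf.continuous_fderiv two_ne_zero).bounded_above_of_compact_support
    (hc.fderiv (𝕜 := ℝ))
  obtain ⟨K₂, hK₂⟩ := (continuous_laplacian hf).bounded_above_of_compact_support hc.laplacian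
  -- Dilations of one bump function: each derivative gains a factor `1 / (n + 1)`. The Laplacian
  -- gains its square, which is weakened below so that both bounds share one rate.
  refine ⟨fun n y => f (((n : ℝ) + 1)⁻¹ • y), max K₁ K₂, fun n => ?_⟩
  have hn : (0 : ℝ) < (n : ℝ) + 1 := by positivity
  refine ⟨hf.comp (by fun_prop), ?_, fun y => ?_, fun y hy => ?_, fun y => ?_, fun y => ?_⟩
  · exact hc.comp_homeomorph (Homeomorph.smulOfNeZero _ (inv_pos.2 hn).ne')
  · rw [abs_of_nonneg f.nonneg]
    exact f.le_one
  · refine f.one_of_mem_closedBall ?_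
    rw [mem_closedBall_zero_iff, norm_smul, norm_inv, Real.norm_of_nonneg hn.le,
      inv_mul_le_iff₀ hn]
    change ‖y‖ ≤ (n + 1) * 1
    linarith
  · rw [fderiv_comp_smul _ (f := f), norm_smul, norm_inv, Real.norm_of_nonneg hn.le,
      div_eq_inv_mul]
    gcongr
    exact (hK₁ _).trans (le_max_left _ _)
  · rw [laplacian_comp_smul hf, abs_mul, div_eq_inv_mul]
    have h0 : ((n : ℝ) + 1)⁻¹ ≤ 1 := inv_le_one_of_one_le₀ (by linarith [n.cast_nonneg (α := ℝ)])
    have h1 : |(((n : ℝ) + 1)⁻¹) ^ 2| ≤ ((n : ℝ) + 1)⁻¹ := by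
      rw [abs_of_nonneg (by positivity)]
      exact pow_le_of_le_one (by positivity) h0 two_ne_zero
    exact mul_le_mul h1 ((hK₂ _).trans (le_max_right _ _)) (abs_nonneg _) (by positivity)

end Cutoff

/-! ### Differentiating the cutoff Gaussian average -/

section LocalizedDuhamel

theorem ContinuousOn.comp_prodMk_univ {X Y Z : Type*} [TopologicalSpace X] [TopologicalSpace Y]
    [TopologicalSpace Z] {q : X → Y → Z} {S : Set X}
    (hq : ContinuousOn (fun p : X × Y => q p.1 p.2) (S ×ˢ univ)) {s : X} (hs : s ∈ S) :
    Continuous (q s) :=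
  hq.comp_continuous (f := fun y => (s, y)) (by fun_prop) fun y => ⟨hs, mem_univ y⟩

theorem ContinuousOn.exists_bound_of_eq_zero {X Y F : Type*} [TopologicalSpace X]
    [TopologicalSpace Y] [NormedAddCommGroup F] {q : X → Y → F} {S : Set X}
    {K : Set Y} (hq : ContinuousOn (fun p : X × Y => q p.1 p.2) (S ×ˢ univ)) (hS : IsCompact S)
    (hK : IsCompact K) (h0 : ∀ s ∈ S, ∀ y ∉ K, q s y = 0) :
    ∃ C, 0 ≤ C ∧ ∀ s ∈ S, ∀ y, ‖q s y‖ ≤ C := by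
  obtain ⟨C, hC⟩ := (hS.prod hK).exists_bound_of_continuousOn
    (hq.mono (prod_mono le_rfl (subset_univ K)))
  refine ⟨max C 0, le_max_right _ _, fun s hs y => ?_⟩
  by_cases hy : y ∈ K
  · exact (hC (s, y) ⟨hs, hy⟩).trans (le_max_left _ _)
  · rw [h0 s hs y hy, norm_zero]
    exact le_max_right _ _

theorem mul_eq_zero_of_notMem_tsupport {Y : Type*} [TopologicalSpace Y] {φ : Y → ℝ} {y : Y}
    (hy : y ∉ tsupport φ) (a : ℝ) : φ y * a = 0 := by
  rw [image_eq_zero_of_notMem_tsupport hy, zero_mul]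

section General

variable {E : Type*} [NormedAddCommGroup E] [InnerProductSpace ℝ E] [FiniteDimensional ℝ E]
  [MeasurableSpace E] [BorelSpace E]

/-- Dominated convergence with a constant bound. It gives continuity up to the endpoints `r = 0` and
`s = T`, where differentiability is not available. -/
theorem continuousOn_integral_stdGaussian_comp {q : ℝ → E → ℝ} {S A : Set ℝ}
    (hq : ContinuousOn (fun p : ℝ × E => q p.1 p.2) (S ×ˢ univ)) {C : ℝ}
    (hC : ∀ s ∈ S, ∀ y, ‖q s y‖ ≤ C) {a b : ℝ → ℝ} (ha : ContinuousOn a A) (hb : ContinuousOn b A)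
    (hA : MapsTo a A S) (x : E) :
    ContinuousOn (fun r => ∫ z, q (a r) (x + b r • z) ∂stdGaussian E) A := by
  refine continuousOn_of_dominated (bound := fun _ => C) (fun r hr => ?_)
    (fun r hr => ae_of_all _ fun z => hC _ (hA hr) _) (integrable_const C)
    (ae_of_all _ fun z => ?_)
  · have := hq.comp_prodMk_univ (hA hr)
    exact Continuous.aestronglyMeasurable (by fun_prop)
  · exact hq.comp (f := fun r => (a r, x + b r • z)) (by fun_prop) fun r hr => ⟨hA hr, mem_univ _⟩

end General

variable {d : ℕ} {T : ℝ} {u h : ℝ → EuclideanSpace ℝ (Fin d) → ℝ}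

theorem IsC12On.hasDerivAt_comp (hu : IsC12On T u) {φ : EuclideanSpace ℝ (Fin d) → ℝ}
    (hφ : ContDiff ℝ 2 φ) {t : ℝ} (ht : 0 ≤ t) (x z : EuclideanSpace ℝ (Fin d)) {r : ℝ}
    (hr : 0 < r) (hrT : t + r ^ 2 < T) :
    HasDerivAt (fun r => φ (x + r • z) * u (t + r ^ 2) (x + r • z))
      (2 * r * (φ (x + r • z) * derivWithin (fun s => u s (x + r • z)) (Ico 0 T) (t + r ^ 2))
        + fderiv ℝ (fun y => φ y * u (t + r ^ 2) y) (x + r • z) z) r := by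
  set s := t + r ^ 2 with hs
  have hs0 : 0 < s := by positivity
  have hnhds : Ico 0 T ×ˢ (univ : Set (EuclideanSpace ℝ (Fin d))) ∈ 𝓝 (s, x + r • z) :=
    prod_mem_nhds (Ico_mem_nhds hs0 hrT) univ_mem
  have hev : ∀ᶠ p in 𝓝 (s, x + r • z), p.1 ∈ Ioo 0 T :=
    continuous_fst.continuousAt.preimage_mem_nhds (Ioo_mem_nhds hs0 hrT)
  have hprod : ∀ s ∈ Ico 0 T, ∀ y, HasFDerivAt (fun y => φ y * u s y)
      (φ y • fderiv ℝ (u s) y + u s y • fderiv ℝ φ y) y := fun s hs y =>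
    (hφ.differentiable two_ne_zero y).hasFDerivAt.mul
      ((hu.contDiff_space s hs).differentiable two_ne_zero y).hasFDerivAt
  -- Jointly continuous partial derivatives give joint differentiability, hence the chain rule along
  -- the curve. As `r > 0` puts `s` in the open interval `(0, T)`, the one-sided time derivative is
  -- a genuine one there.
  have key := hasStrictFDerivAt_uncurry_coprod (𝕜 := ℝ) (u := (s, x + r • z))
    (f := fun s y => φ y * u s y)
    (f₁ := fun s y => ContinuousLinearMap.toSpanSingleton ℝ
      (φ y * derivWithin (fun s => u s y) (Ico 0 T) s))
    (f₂ := fun s y => φ y • fderiv ℝ (u s) y + u s y • fderiv ℝ φ y) ?_ ?_ ?_ ?_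
  · have hcurve : HasDerivAt (fun r : ℝ => (t + r ^ 2, x + r • z)) (2 * r, z) r := by
      have h1 : HasDerivAt (fun r : ℝ => t + r ^ 2) (2 * r) r := by
        simpa using (hasDerivAt_pow 2 r).const_add t
      have h2 : HasDerivAt (fun r : ℝ => x + r • z) z r := by
        simpa using ((hasDerivAt_id r).smul_const z).const_add x
      exact h1.prodMk h2
    have := key.hasFDerivAt.comp_hasDerivAt r hcurve
    rw [(hprod s ⟨hs0.le, hrT⟩ _).fderiv]
    refine this.congr_deriv ?_
    simp [Function.HasUncurry.uncurry]
  · filter_upwards [hev] with p hp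
    have h1 : HasDerivAt (fun s => u s p.2) (derivWithin (fun s => u s p.2) (Ico 0 T) p.1) p.1 :=
      ((hu.differentiableOn_time p.2 p.1 ⟨hp.1.le, hp.2⟩).hasDerivWithinAt).hasDerivAt
        (Ico_mem_nhds hp.1 hp.2)
    exact (h1.const_mul (φ p.2)).hasFDerivAt
  · filter_upwards [hev] with p hp
    exact hprod p.1 ⟨hp.1.le, hp.2⟩ p.2
  · have h1 := hu.continuousOn_time_deriv.continuousAt hnhds
    have h2 : ContinuousAt (fun p : ℝ × EuclideanSpace ℝ (Fin d) => φ p.2) (s, x + r • z) :=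
      (hφ.continuous.comp continuous_snd).continuousAt
    exact (ContinuousLinearMap.toSpanSingletonCLE (𝕜 := ℝ) (E := ℝ)).continuous.continuousAt.comp
      (h2.mul h1)
  · have h1 := hu.continuousOn_space_fderiv.continuousAt hnhds
    have h2 : ContinuousAt (fun p : ℝ × EuclideanSpace ℝ (Fin d) => φ p.2) (s, x + r • z) :=
      (hφ.continuous.comp continuous_snd).continuousAt
    have h3 := hu.continuousOn.continuousAt hnhds
    have h4 : ContinuousAt (fun p : ℝ × EuclideanSpace ℝ (Fin d) => fderiv ℝ φ p.2)
      (s, x + r • z) := ((hφ.continuous_fderiv two_ne_zero).comp continuous_snd).continuousAt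
    exact (h2.smul h1).add (h3.smul h4)

theorem IsC12On.hasDerivAt_integral (hu : IsC12On T u) {φ : EuclideanSpace ℝ (Fin d) → ℝ}
    (hφ : ContDiff ℝ 2 φ) (hc : HasCompactSupport φ) {t : ℝ} (ht : 0 ≤ t)
    (x : EuclideanSpace ℝ (Fin d)) {r₀ : ℝ} (hr₀ : 0 < r₀) (hrT : t + r₀ ^ 2 < T) :
    HasDerivAt (fun r => ∫ z, φ (x + r • z) * u (t + r ^ 2) (x + r • z) ∂stdGaussian _)
      (2 * r₀ * ∫ z, φ (x + r₀ • z) *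
          derivWithin (fun s => u s (x + r₀ • z)) (Ico 0 T) (t + r₀ ^ 2) ∂stdGaussian _
        + ∫ z, fderiv ℝ (fun y => φ y * u (t + r₀ ^ 2) y) (x + r₀ • z) z ∂stdGaussian _) r₀ := by
  -- Room to the right of `r₀` keeps all nearby times in a compact subinterval of `[0, T)`, where
  -- the derivatives of `φ u` are bounded uniformly.
  obtain ⟨r₁, hr₁, hr₁T⟩ : ∃ r₁, r₀ < r₁ ∧ t + r₁ ^ 2 < T := by
    have hcont : ContinuousAt (fun r : ℝ => t + r ^ 2) r₀ := by fun_prop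
    have hlt : ∀ᶠ r in 𝓝[>] r₀, t + r ^ 2 < T :=
      (hcont.eventually_lt_const hrT).filter_mono nhdsWithin_le_nhds
    have hgt : ∀ᶠ r in 𝓝[>] r₀, r₀ < r := self_mem_nhdsWithin
    exact (hgt.and hlt).exists
  set J := Icc t (t + r₁ ^ 2) with hJ
  have hJsub : J ⊆ Ico 0 T := fun s hs => ⟨ht.trans hs.1, hs.2.trans_lt hr₁T⟩
  have hJsub' : J ×ˢ (univ : Set (EuclideanSpace ℝ (Fin d))) ⊆ Ico 0 T ×ˢ univ :=
    prod_mono hJsub le_rfl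
  have hJmem : ∀ r ∈ Ioo 0 r₁, t + r ^ 2 ∈ J := fun r hr =>
    ⟨by nlinarith [hr.1], by nlinarith [hr.1, hr.2]⟩
  have hφc : Continuous φ := hφ.continuous
  have hφc2 : ContinuousOn (fun p : ℝ × EuclideanSpace ℝ (Fin d) => φ p.2) (J ×ˢ univ) :=
    (hφc.comp continuous_snd).continuousOn
  have hdc2 : ContinuousOn (fun p : ℝ × EuclideanSpace ℝ (Fin d) => fderiv ℝ φ p.2)
    (J ×ˢ univ) := ((hφ.continuous_fderiv two_ne_zero).comp continuous_snd).continuousOn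
  have hprod : ∀ s ∈ Ico 0 T, ∀ y, fderiv ℝ (fun y => φ y * u s y) y =
      φ y • fderiv ℝ (u s) y + u s y • fderiv ℝ φ y := fun s hs y =>
    ((hφ.differentiable two_ne_zero y).hasFDerivAt.mul
      ((hu.contDiff_space s hs).differentiable two_ne_zero y).hasFDerivAt).fderiv
  have hu_t := hu.continuousOn_time_deriv.mono hJsub'
  obtain ⟨C₁, hC₁0, hC₁⟩ := ContinuousOn.exists_bound_of_eq_zero
    (q := fun s y => φ y * derivWithin (fun s => u s y) (Ico 0 T) s) (S := J)
    (hφc2.mul hu_t) isCompact_Icc hc.isCompact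
    fun s _ y hy => mul_eq_zero_of_notMem_tsupport hy _
  have hDc : ContinuousOn (fun p : ℝ × EuclideanSpace ℝ (Fin d) =>
      fderiv ℝ (fun y => φ y * u p.1 y) p.2) (J ×ˢ univ) := by
    refine ContinuousOn.congr (f := fun p : ℝ × EuclideanSpace ℝ (Fin d) =>
      φ p.2 • fderiv ℝ (u p.1) p.2 + u p.1 p.2 • fderiv ℝ φ p.2) ?_
      fun p hp => hprod p.1 (hJsub hp.1) p.2
    exact (hφc2.smul (hu.continuousOn_space_fderiv.mono hJsub')).add
      ((hu.continuousOn.mono hJsub').smul hdc2)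
  obtain ⟨C₂, hC₂0, hC₂⟩ := ContinuousOn.exists_bound_of_eq_zero
    (q := fun s y => fderiv ℝ (fun y => φ y * u s y) y) (S := J) (K := tsupport φ)
    hDc isCompact_Icc hc.isCompact fun s hs y hy => by
      have : y ∉ tsupport fun y => φ y * u s y := fun h' => hy (tsupport_mul_subset_left h')
      exact image_eq_zero_of_notMem_tsupport fun h' => this (tsupport_fderiv_subset ℝ h')
  have hslice : ∀ r ∈ Ioo 0 r₁, Continuous fun z => φ (x + r • z) * u (t + r ^ 2) (x + r • z) :=
    fun r hr => by
      have := hu.continuousOn.comp_prodMk_univ (hJsub (hJmem r hr))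
      fun_prop
  have hr₀mem : r₀ ∈ Ioo 0 r₁ := ⟨hr₀, hr₁⟩
  have hs₀ := hJmem r₀ hr₀mem
  have hcont1 : Continuous fun z => φ (x + r₀ • z) *
      derivWithin (fun s => u s (x + r₀ • z)) (Ico 0 T) (t + r₀ ^ 2) := by
    have := ContinuousOn.comp_prodMk_univ
      (q := fun s y => derivWithin (fun s => u s y) (Ico 0 T) s) hu_t hs₀
    exact (by fun_prop : Continuous fun z => φ (x + r₀ • z)).mul
      (this.comp (by fun_prop : Continuous fun z => x + r₀ • z))
  have hcont2 : Continuous fun z =>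
      fderiv ℝ (fun y => φ y * u (t + r₀ ^ 2) y) (x + r₀ • z) z := by
    have := ContinuousOn.comp_prodMk_univ
      (q := fun s y => fderiv ℝ (fun y => φ y * u s y) y) hDc hs₀
    fun_prop
  have hnorm : Integrable (fun z : EuclideanSpace ℝ (Fin d) => ‖z‖) (stdGaussian _) :=
    IsGaussian.integrable_fun_id.norm
  have hI1 : Integrable (fun z => φ (x + r₀ • z) *
      derivWithin (fun s => u s (x + r₀ • z)) (Ico 0 T) (t + r₀ ^ 2)) (stdGaussian _) :=
    Integrable.of_bound hcont1.aestronglyMeasurable C₁ (ae_of_all _ fun z => hC₁ _ hs₀ _)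
  have hI2 : Integrable (fun z =>
      fderiv ℝ (fun y => φ y * u (t + r₀ ^ 2) y) (x + r₀ • z) z) (stdGaussian _) :=
    (hnorm.const_mul C₂).mono' hcont2.aestronglyMeasurable
      (ae_of_all _ fun z => ContinuousLinearMap.le_of_opNorm_le _ (hC₂ _ hs₀ _) _)
  rw [← integral_const_mul, ← integral_add (hI1.const_mul _) hI2]
  -- The spatial derivative is taken in direction `z`, so the dominating function grows linearly in
  -- `‖z‖`, which is Gaussian-integrable.
  refine (hasDerivAt_integral_of_dominated_loc_of_deriv_le (s := Ioo 0 r₁)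
    (bound := fun z => 2 * r₁ * C₁ + C₂ * ‖z‖)
    (F' := fun r z => 2 * r * (φ (x + r • z) *
        derivWithin (fun s => u s (x + r • z)) (Ico 0 T) (t + r ^ 2))
        + fderiv ℝ (fun y => φ y * u (t + r ^ 2) y) (x + r • z) z)
    (Ioo_mem_nhds hr₀ hr₁) ?_ ?_ ?_ ?_ ?_ ?_).2
  · filter_upwards [Ioo_mem_nhds hr₀ hr₁] with r hr
    exact (hslice r hr).aestronglyMeasurable
  · exact (hslice r₀ hr₀mem).integrable_of_hasCompactSupport
      (hc.comp_add_smul x hr₀.ne').mul_right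
  · exact ((hcont1.const_mul _).add hcont2).aestronglyMeasurable
  · refine ae_of_all _ fun z r hr => (norm_add_le _ _).trans (add_le_add ?_ ?_)
    · rw [norm_mul]
      refine mul_le_mul ?_ (hC₁ _ (hJmem r hr) _) (norm_nonneg _) (by linarith [hr₀mem.1])
      rw [Real.norm_of_nonneg (by linarith [hr.1])]
      linarith [hr.2]
    · exact ContinuousLinearMap.le_of_opNorm_le _ (hC₂ _ (hJmem r hr) _) _
  · exact (integrable_const _).add (hnorm.const_mul _)
  · exact ae_of_all _ fun z r hr => hu.hasDerivAt_comp hφ ht x z hr.1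
      ((hJsub (hJmem r hr)).2)

end LocalizedDuhamel

/-! ### Duhamel formula with a cutoff error -/

section LocalizedDuhamelEstimate

variable {d : ℕ} {T : ℝ} {u h : ℝ → EuclideanSpace ℝ (Fin d) → ℝ}

theorem IsC12On.hasDerivAt_integral_of_heat (hu : IsC12On T u)
    (hpde : ∀ t ∈ Ico 0 T, ∀ x,
      derivWithin (fun s => u s x) (Ico 0 T) t + 1 / 2 * Laplacian.laplacian (u t) x + h t x = 0)
    {φ : EuclideanSpace ℝ (Fin d) → ℝ}
    (hφ : ContDiff ℝ 2 φ) (hc : HasCompactSupport φ) {t : ℝ} (ht : 0 ≤ t)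
    (x : EuclideanSpace ℝ (Fin d)) {r : ℝ} (hr : 0 < r) (hrT : t + r ^ 2 < T) :
    HasDerivAt (fun r => ∫ z, φ (x + r • z) * u (t + r ^ 2) (x + r • z) ∂stdGaussian _)
      (2 * ∫ z, u (t + r ^ 2) (x + r • z) * fderiv ℝ φ (x + r • z) z ∂stdGaussian _
        - r * ∫ z, u (t + r ^ 2) (x + r • z) * Laplacian.laplacian φ (x + r • z) ∂stdGaussian _
        - 2 * r * ∫ z, φ (x + r • z) * h (t + r ^ 2) (x + r • z) ∂stdGaussian _) r := by
  have hs : t + r ^ 2 ∈ Ico 0 T := ⟨by positivity, hrT⟩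
  refine (hu.hasDerivAt_integral hφ hc ht x hr hrT).congr_deriv ?_
  rw [integral_fderiv_mul_stdGaussian_comp (hu.contDiff_space _ hs) hφ hc x hr.ne']
  have hφc := hφ.continuous
  have I1 : Integrable (fun z => φ (x + r • z) *
      derivWithin (fun s => u s (x + r • z)) (Ico 0 T) (t + r ^ 2)) (stdGaussian _) :=
    Continuous.integrable_stdGaussian_comp
      (g := fun y => φ y * derivWithin (fun s => u s y) (Ico 0 T) (t + r ^ 2))
      (hφc.mul (ContinuousOn.comp_prodMk_univ
        (q := fun s y => derivWithin (fun s => u s y) (Ico 0 T) s) hu.continuousOn_time_deriv hs))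
      hc.mul_right x hr.ne'
  have I2 : Integrable (fun z => φ (x + r • z) *
      Laplacian.laplacian (u (t + r ^ 2)) (x + r • z)) (stdGaussian _) :=
    Continuous.integrable_stdGaussian_comp
      (g := fun y => φ y * Laplacian.laplacian (u (t + r ^ 2)) y)
      (hφc.mul (continuous_laplacian (hu.contDiff_space _ hs))) hc.mul_right x hr.ne'
  -- The equation multiplied by `φ` and averaged; it absorbs both the time derivative and `Δu`.
  have I3 : ∫ z, φ (x + r • z) * h (t + r ^ 2) (x + r • z) ∂stdGaussian _ =
      - ∫ z, φ (x + r • z) *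
          derivWithin (fun s => u s (x + r • z)) (Ico 0 T) (t + r ^ 2) ∂stdGaussian _
      - 1 / 2 * ∫ z, φ (x + r • z) *
          Laplacian.laplacian (u (t + r ^ 2)) (x + r • z) ∂stdGaussian _ := by
    have I1n : Integrable (fun z => -(φ (x + r • z) *
      derivWithin (fun s => u s (x + r • z)) (Ico 0 T) (t + r ^ 2))) (stdGaussian _) := I1.neg
    rw [← integral_const_mul, ← integral_neg, ← integral_sub I1n (I2.const_mul _)]
    refine integral_congr_ae (ae_of_all _ fun z => ?_)
    have := hpde _ hs (x + r • z)
    simp only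
    linear_combination φ (x + r • z) * this
  rw [I3]
  ring

theorem IsC12On.abs_duhamel_cutoff_le (hT : 0 < T) (hu12 : IsC12On T u)
    (hu : ContinuousOn (fun p : ℝ × EuclideanSpace ℝ (Fin d) => u p.1 p.2) (Icc 0 T ×ˢ univ))
    (hh : ContinuousOn (fun p : ℝ × EuclideanSpace ℝ (Fin d) => h p.1 p.2) (Icc 0 T ×ˢ univ))
    {C : ℝ} (hC : ∀ s ∈ Icc 0 T, ∀ y, |u s y| ≤ C)
    (hpde : ∀ t ∈ Ico 0 T, ∀ x,
      derivWithin (fun s => u s x) (Ico 0 T) t + 1 / 2 * Laplacian.laplacian (u t) x + h t x = 0)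
    {φ : EuclideanSpace ℝ (Fin d) → ℝ} (hφ : ContDiff ℝ 2 φ) (hc : HasCompactSupport φ)
    {ε : ℝ} (hφ1 : ∀ y, ‖fderiv ℝ φ y‖ ≤ ε) (hφ2 : ∀ y, |Laplacian.laplacian φ y| ≤ ε)
    {t : ℝ} (ht : t ∈ Ico 0 T) (x : EuclideanSpace ℝ (Fin d)) :
    |∫ z, φ (x + √(T - t) • z) * u T (x + √(T - t) • z) ∂stdGaussian _ - φ x * u t x
      + ∫ s in t..T, ∫ z, φ (x + √(s - t) • z) * h s (x + √(s - t) • z) ∂stdGaussian _| ≤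
    √(T - t) * (C * ε * (2 * ∫ z, ‖z‖ ∂stdGaussian (EuclideanSpace ℝ (Fin d)) + √(T - t))) := by
  set ρ := √(T - t) with hρ
  have hρ0 : 0 < ρ := Real.sqrt_pos.2 (by linarith [ht.2])
  have hρ2 : ρ ^ 2 = T - t := Real.sq_sqrt (by linarith [ht.2])
  have hC0 : 0 ≤ C := (abs_nonneg _).trans (hC T ⟨hT.le, le_rfl⟩ 0)
  have hε0 : 0 ≤ ε := (norm_nonneg _).trans (hφ1 0)
  have hφc2 : ContinuousOn (fun p : ℝ × EuclideanSpace ℝ (Fin d) => φ p.2) (Icc 0 T ×ˢ univ) :=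
    (hφ.continuous.comp continuous_snd).continuousOn
  have hqu : ContinuousOn (fun p : ℝ × EuclideanSpace ℝ (Fin d) => φ p.2 * u p.1 p.2)
    (Icc 0 T ×ˢ univ) := hφc2.mul hu
  have hqh : ContinuousOn (fun p : ℝ × EuclideanSpace ℝ (Fin d) => φ p.2 * h p.1 p.2)
    (Icc 0 T ×ˢ univ) := hφc2.mul hh
  obtain ⟨Cu, -, hCu⟩ := ContinuousOn.exists_bound_of_eq_zero (q := fun s y => φ y * u s y)
    hqu isCompact_Icc hc.isCompact fun s _ y hy => mul_eq_zero_of_notMem_tsupport hy _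
  obtain ⟨Ch, -, hCh⟩ := ContinuousOn.exists_bound_of_eq_zero (q := fun s y => φ y * h s y)
    hqh isCompact_Icc hc.isCompact fun s _ y hy => mul_eq_zero_of_notMem_tsupport hy _
  set F : ℝ → ℝ := fun r =>
    ∫ z, φ (x + r • z) * u (t + r ^ 2) (x + r • z) ∂stdGaussian _ with hF
  set m : ℝ → ℝ := fun s =>
    ∫ z, φ (x + √(s - t) • z) * h s (x + √(s - t) • z) ∂stdGaussian _ with hm
  have hmaps : MapsTo (fun r : ℝ => t + r ^ 2) (Icc 0 ρ) (Icc t T) := fun r hr =>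
    ⟨by nlinarith [hr.1], by nlinarith [hr.1, hr.2]⟩
  have hsub : Icc t T ⊆ Icc 0 T := Icc_subset_Icc_left ht.1
  have hFc : ContinuousOn F (Icc 0 ρ) :=
    continuousOn_integral_stdGaussian_comp (q := fun s y => φ y * u s y) hqu hCu
      (a := fun r => t + r ^ 2) (b := fun r => r) (by fun_prop) (by fun_prop)
      (fun r hr => hsub (hmaps hr)) x
  have hmc : ContinuousOn m (Icc t T) :=
    continuousOn_integral_stdGaussian_comp (q := fun s y => φ y * h s y) hqh hCh
      (a := fun s => s) (b := fun s => √(s - t)) (by fun_prop) (by fun_prop)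
      (fun r hr => hsub hr) x
  have hmint : IntervalIntegrable m volume t T := by
    refine ContinuousOn.intervalIntegrable ?_
    rwa [uIcc_of_le ht.2.le]
  -- The added source integral has derivative `2r m(t + r²)`, which cancels the `h` term of `F'` and
  -- leaves only the cutoff errors `D`.
  set G : ℝ → ℝ := fun r => F r + ∫ s in t..(t + r ^ 2), m s with hG
  have hGc : ContinuousOn G (Icc 0 ρ) := by
    refine hFc.add ?_
    have := intervalIntegral.continuousOn_primitive_interval (μ := volume) (f := m) (a := t)
      (b := T) (by
        rw [uIcc_of_le ht.2.le]
        exact hmc.integrableOn_Icc)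
    rw [uIcc_of_le ht.2.le] at this
    exact this.comp (by fun_prop) hmaps
  set D : ℝ → ℝ := fun r =>
    2 * ∫ z, u (t + r ^ 2) (x + r • z) * fderiv ℝ φ (x + r • z) z ∂stdGaussian _
    - r * ∫ z, u (t + r ^ 2) (x + r • z) * Laplacian.laplacian φ (x + r • z) ∂stdGaussian _
    with hD
  have hGd : ∀ r ∈ Ioo 0 ρ, HasDerivAt G (D r) r := fun r hr => by
    have hrT : t + r ^ 2 < T := by nlinarith [hr.1, hr.2]
    have htr : t < t + r ^ 2 := by have := hr.1; simpa using pow_pos this 2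
    have h1 := hu12.hasDerivAt_integral_of_heat hpde hφ hc ht.1 x hr.1 hrT
    have h2 : HasDerivAt (fun s => ∫ σ in t..s, m σ) (m (t + r ^ 2)) (t + r ^ 2) := by
      have hn : Icc t T ∈ 𝓝 (t + r ^ 2) := Icc_mem_nhds htr hrT
      refine intervalIntegral.integral_hasDerivAt_right
        (hmint.mono_set ?_) ?_ (hmc.continuousAt hn)
      · rw [uIcc_of_le htr.le, uIcc_of_le ht.2.le]
        exact Icc_subset_Icc_right hrT.le
      · exact (hmc.mono Ioo_subset_Icc_self).stronglyMeasurableAtFilter isOpen_Ioo _ ⟨htr, hrT⟩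
    have h3 : HasDerivAt (fun r : ℝ => t + r ^ 2) (2 * r) r := by
      simpa using (hasDerivAt_pow 2 r).const_add t
    have hmr : m (t + r ^ 2) =
        ∫ z, φ (x + r • z) * h (t + r ^ 2) (x + r • z) ∂stdGaussian _ := by
      simp only [hm, add_sub_cancel_left, Real.sqrt_sq hr.1.le]
    refine (h1.add (HasDerivAt.comp r h2 h3)).congr_deriv ?_
    rw [hmr]
    simp only [hD]
    ring
  -- The mean value theorem needs only continuity at the endpoints, so neither regularity of `u` at
  -- time `T` nor integrability of `D` is required.
  obtain ⟨r, hr, hslope⟩ := exists_hasDerivAt_eq_slope G D hρ0 hGc hGd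
  have hsr := hsub (hmaps ⟨hr.1.le, hr.2.le⟩)
  have hnorm : Integrable (fun z : EuclideanSpace ℝ (Fin d) => ‖z‖) (stdGaussian _) :=
    IsGaussian.integrable_fun_id.norm
  have B1 : |∫ z, u (t + r ^ 2) (x + r • z) * fderiv ℝ φ (x + r • z) z ∂stdGaussian _| ≤
      C * ε * ∫ z, ‖z‖ ∂stdGaussian (EuclideanSpace ℝ (Fin d)) := by
    rw [← integral_const_mul, ← Real.norm_eq_abs]
    refine norm_integral_le_of_norm_le (hnorm.const_mul _) (ae_of_all _ fun z => ?_)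
    rw [norm_mul, mul_assoc]
    exact mul_le_mul (hC _ hsr _) (ContinuousLinearMap.le_of_opNorm_le _ (hφ1 _) _)
      (norm_nonneg _) hC0
  have B2 : |∫ z, u (t + r ^ 2) (x + r • z) *
      Laplacian.laplacian φ (x + r • z) ∂stdGaussian _| ≤ C * ε := by
    have := norm_integral_le_of_norm_le_const (μ := stdGaussian (EuclideanSpace ℝ (Fin d)))
      (f := fun z => u (t + r ^ 2) (x + r • z) * Laplacian.laplacian φ (x + r • z)) (C := C * ε)
      (ae_of_all _ fun z => by
        rw [norm_mul]
        exact mul_le_mul (hC _ hsr _) (hφ2 _) (norm_nonneg _) hC0)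
    simpa using this
  have BD : |D r| ≤ C * ε * (2 * ∫ z, ‖z‖ ∂stdGaussian (EuclideanSpace ℝ (Fin d)) + ρ) := by
    refine (abs_sub _ _).trans ?_
    rw [abs_mul, abs_mul, abs_two, abs_of_pos hr.1]
    have : r * |∫ z, u (t + r ^ 2) (x + r • z) *
      Laplacian.laplacian φ (x + r • z) ∂stdGaussian _| ≤ ρ * (C * ε) :=
      mul_le_mul hr.2.le B2 (abs_nonneg _) hρ0.le
    linarith
  have hGρ : G ρ = ∫ z, φ (x + ρ • z) * u T (x + ρ • z) ∂stdGaussian _ + ∫ s in t..T, m s := by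
    simp only [hG, hF, hρ2, add_sub_cancel]
  have hG0 : G 0 = φ x * u t x := by simp [hG, hF]
  have hdiff : G ρ - G 0 = ρ * D r := by
    rw [hslope, sub_zero]
    field_simp
  have : ∫ z, φ (x + ρ • z) * u T (x + ρ • z) ∂stdGaussian _ - φ x * u t x + ∫ s in t..T, m s
      = ρ * D r := by rw [← hdiff, hGρ, hG0]; ring
  rw [this, abs_mul, abs_of_pos hρ0]
  exact mul_le_mul_of_nonneg_left BD hρ0.le

end LocalizedDuhamelEstimate

/-! ### Laws and joint measurability for Brownian motion -/

section BrownianMotion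

theorem multivariateGaussian_zero_smul_one {d : ℕ} {c : ℝ} (hc : 0 ≤ c) :
    multivariateGaussian 0 (c • (1 : Matrix (Fin d) (Fin d) ℝ)) =
      (stdGaussian (EuclideanSpace ℝ (Fin d))).map (fun z => √c • z) := by
  have hm : IsProbabilityMeasure ((stdGaussian (EuclideanSpace ℝ (Fin d))).map
    (fun z => √c • z)) := Measure.isProbabilityMeasure_map (by fun_prop)
  refine Measure.ext_of_charFun (funext fun x => ?_)
  rw [charFun_multivariateGaussian (Matrix.PosSemidef.one.smul hc), charFun_map_smul,
    charFun_stdGaussian]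
  congr 1
  rw [norm_smul, Real.norm_of_nonneg (Real.sqrt_nonneg _)]
  have h1 : dotProduct x.ofLp x.ofLp = ‖x‖ ^ 2 := by
    rw [EuclideanSpace.real_norm_sq_eq]
    simp [dotProduct, sq]
  have h2 : ((√c : ℝ) : ℂ) ^ 2 = c := by
    rw [← Complex.ofReal_pow, Real.sq_sqrt hc]
  simp only [inner_zero_right, Complex.ofReal_zero, zero_mul, zero_sub, Matrix.smul_mulVec,
    Matrix.one_mulVec, dotProduct_smul, h1, smul_eq_mul]
  push_cast
  rw [mul_pow, h2]
  ring

variable {d : ℕ} {Ω : Type*} [MeasurableSpace Ω] {T : ℝ}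
  {W : ℝ → Ω → EuclideanSpace ℝ (Fin d)} {P : Measure Ω}

theorem IsStandardBrownianOn.integral_comp (hW : IsStandardBrownianOn T W P)
    {t s : ℝ} (ht : 0 ≤ t) (hts : t ≤ s) (hs : s ≤ T) {g : EuclideanSpace ℝ (Fin d) → ℝ}
    (hg : Continuous g) (x : EuclideanSpace ℝ (Fin d)) :
    ∫ ω, g (x + W s ω - W t ω) ∂P = ∫ z, g (x + √(s - t) • z) ∂stdGaussian _ := by
  have h1 := (hW.gaussian_increments t s ht hts hs).integral_comp (f := fun y => g (x + y))
    (Continuous.aestronglyMeasurable (by fun_prop))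
  rw [multivariateGaussian_zero_smul_one (sub_nonneg.2 hts), integral_map (by fun_prop)
    (Continuous.aestronglyMeasurable (by fun_prop))] at h1
  rw [← h1]
  simp only [Function.comp_def, add_sub_assoc]

/-- Almost sure path continuity makes `W` an almost everywhere limit of processes that are piecewise
constant in time, sampled at grid points. Countably many samples are involved, so all can be
replaced by measurable versions off one null set. -/
theorem IsStandardBrownianOn.aemeasurable_uncurry [SFinite P] (hT : 0 ≤ T)
    (hW : IsStandardBrownianOn T W P) :
    AEMeasurable (fun p : ℝ × Ω => W p.1 p.2) ((volume.restrict (Icc 0 T)).prod P) := by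
  -- Truncating at `T` keeps every grid point in `[0, T]`; for `n = 0` the division gives the
  -- harmless value `0`.
  set τ : ℕ → ℕ → ℝ := fun n k => min T ((k : ℝ) / n) with hτ
  have hτmem : ∀ n k, τ n k ∈ Icc 0 T := fun n k => ⟨le_min hT (by positivity), min_le_left _ _⟩
  set V : ℕ → ℕ → Ω → EuclideanSpace ℝ (Fin d) := fun n k =>
    (hW.aemeasurable _ (hτmem n k)).mk _ with hV
  have hVm : ∀ n k, Measurable (V n k) := fun n k => (hW.aemeasurable _ (hτmem n k)).measurable_mk
  have hVe : ∀ᵐ ω ∂P, ∀ n k, W (τ n k) ω = V n k ω := by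
    rw [ae_all_iff]
    intro n
    rw [ae_all_iff]
    exact fun k => (hW.aemeasurable _ (hτmem n k)).ae_eq_mk
  refine aemeasurable_of_tendsto_metrizable_ae (u := atTop)
    (f := fun n (p : ℝ × Ω) => V n ⌊p.1 * n⌋₊ p.2) (fun n => ?_) ?_
  · have h1 : Measurable fun q : ℕ × Ω => V n q.1 q.2 :=
      measurable_from_prod_countable_right fun k => hVm n k
    have h2 : Measurable fun p : ℝ × Ω => (⌊p.1 * n⌋₊, p.2) :=
      (Nat.measurable_floor.comp (measurable_fst.mul_const _)).prodMk measurable_snd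
    exact (h1.comp h2).aemeasurable
  · have hω : ∀ᵐ p ∂(volume.restrict (Icc 0 T)).prod P,
        (∀ n k, W (τ n k) p.2 = V n k p.2) ∧ ContinuousOn (fun t => W t p.2) (Icc 0 T) :=
      Measure.quasiMeasurePreserving_snd.ae (hVe.and hW.continuous_paths)
    have hs : ∀ᵐ p ∂(volume.restrict (Icc 0 T)).prod P, p.1 ∈ Icc 0 T :=
      Measure.quasiMeasurePreserving_fst.ae (ae_restrict_mem measurableSet_Icc)
    filter_upwards [hω, hs] with p hp hps
    simp only [← hp.1]
    have hlim : Tendsto (fun n : ℕ => τ n ⌊p.1 * n⌋₊) atTop (𝓝 p.1) := by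
      have := (tendsto_nat_floor_mul_div_atTop hps.1).comp
        (tendsto_natCast_atTop_atTop (R := ℝ))
      have h2 := (tendsto_const_nhds (x := T)).min this
      rwa [min_eq_right hps.2] at h2
    exact (hp.2 p.1 hps).tendsto.comp
      (tendsto_nhdsWithin_iff.2 ⟨hlim, Eventually.of_forall fun n => hτmem _ _⟩)

theorem IsStandardBrownianOn.aestronglyMeasurable_comp [SFinite P] (hT : 0 ≤ T)
    (hW : IsStandardBrownianOn T W P) {h : ℝ → EuclideanSpace ℝ (Fin d) → ℝ}
    (hh : ContinuousOn (fun p : ℝ × EuclideanSpace ℝ (Fin d) => h p.1 p.2) (Icc 0 T ×ˢ univ))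
    {t : ℝ} (ht : t ∈ Icc 0 T) (x : EuclideanSpace ℝ (Fin d)) :
    AEStronglyMeasurable (fun p : ℝ × Ω => h p.1 (x + W p.1 p.2 - W t p.2))
      ((volume.restrict (Icc t T)).prod P) := by
  have hmono : (volume.restrict (Icc t T)).prod P ≤ (volume.restrict (Icc 0 T)).prod P :=
    Measure.prod_mono (Measure.restrict_mono (Icc_subset_Icc_left ht.1) le_rfl) le_rfl
  have h1 : AEMeasurable (fun p : ℝ × Ω => x + W p.1 p.2 - W t p.2)
      ((volume.restrict (Icc t T)).prod P) :=
    (((hW.aemeasurable_uncurry hT).mono_measure hmono).const_add x).sub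
      ((hW.aemeasurable t ht).comp_quasiMeasurePreserving Measure.quasiMeasurePreserving_snd)
  -- Clamping time to `[0, T]` extends `h` to a globally continuous, hence measurable, function that
  -- agrees with `h` on the times that matter.
  have h2 : Continuous fun q : ℝ × EuclideanSpace ℝ (Fin d) => h (max 0 (min T q.1)) q.2 :=
    hh.comp_continuous (f := fun q : ℝ × EuclideanSpace ℝ (Fin d) => (max 0 (min T q.1), q.2))
      (by fun_prop) fun q => ⟨⟨le_max_left _ _, max_le hT (min_le_left _ _)⟩, mem_univ _⟩
  have h3 := h2.measurable.comp_aemeasurable (measurable_fst.aemeasurable.prodMk h1)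
  refine h3.aestronglyMeasurable.congr ?_
  have hs : ∀ᵐ p ∂(volume.restrict (Icc t T)).prod P, p.1 ∈ Icc t T :=
    Measure.quasiMeasurePreserving_fst.ae (ae_restrict_mem measurableSet_Icc)
  filter_upwards [hs] with p hp
  simp only [Function.comp_apply]
  rw [min_eq_right hp.2, max_eq_right (ht.1.trans hp.1)]

theorem IsStandardBrownianOn.integrable_comp_prod [SFinite P] (hT : 0 ≤ T)
    (hW : IsStandardBrownianOn T W P) {h : ℝ → EuclideanSpace ℝ (Fin d) → ℝ}
    (hh : ContinuousOn (fun p : ℝ × EuclideanSpace ℝ (Fin d) => h p.1 p.2) (Icc 0 T ×ˢ univ))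
    {t : ℝ} (ht : t ∈ Icc 0 T) (x : EuclideanSpace ℝ (Fin d))
    (hint : ∫⁻ ω, (∫⁻ s in Icc t T, ENNReal.ofReal |h s (x + W s ω - W t ω)|) ∂P < ⊤) :
    Integrable (fun p : ℝ × Ω => h p.1 (x + W p.1 p.2 - W t p.2))
      ((volume.restrict (Icc t T)).prod P) := by
  have hm := hW.aestronglyMeasurable_comp hT hh ht x
  refine ⟨hm, ?_⟩
  rw [HasFiniteIntegral, lintegral_prod_symm _ hm.enorm]
  simpa only [Real.enorm_eq_ofReal_abs] using hint

end BrownianMotion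

/-! ### Removing the cutoff -/

theorem lemma3p3 {d : ℕ} (hd : 0 < d) {T : ℝ} (hT : 0 < T)
    (u h : ℝ → EuclideanSpace ℝ (Fin d) → ℝ)
    (hu : ContinuousOn (fun p : ℝ × EuclideanSpace ℝ (Fin d) => u p.1 p.2) (Icc 0 T ×ˢ univ))
    (hh : ContinuousOn (fun p : ℝ × EuclideanSpace ℝ (Fin d) => h p.1 p.2) (Icc 0 T ×ˢ univ))
    {Ω : Type*} [MeasurableSpace Ω] (P : Measure Ω) [IsProbabilityMeasure P]
    (W : ℝ → Ω → EuclideanSpace ℝ (Fin d)) (hW : IsStandardBrownianOn T W P)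
    (hu_bdd : ∃ C : ℝ, ∀ s ∈ Icc 0 T, ∀ y, |u s y| ≤ C)
    (hh_int : ∀ t ∈ Ico 0 T, ∀ x,
      ∫⁻ ω, (∫⁻ s in Icc t T, ENNReal.ofReal |h s (x + W s ω - W t ω)|) ∂P < ⊤)
    (hu_C12 : IsC12On T u)
    (hpde : ∀ t ∈ Ico 0 T, ∀ x,
      derivWithin (fun s => u s x) (Ico 0 T) t + 1 / 2 * Laplacian.laplacian (u t) x + h t x = 0) :
    ∀ t ∈ Icc 0 T, ∀ x,
      Integrable (fun ω => u T (x + W T ω - W t ω) + ∫ s in t..T, h s (x + W s ω - W t ω)) P ∧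
      u t x = ∫ ω, (u T (x + W T ω - W t ω) + ∫ s in t..T, h s (x + W s ω - W t ω)) ∂P := by
  obtain ⟨C, hC⟩ := hu_bdd
  intro t ht x
  -- At `t = T` the increment and the time integral both vanish.
  rcases ht.2.eq_or_lt with rfl | htT
  · simp
  have hTmem : T ∈ Icc 0 T := ⟨hT.le, le_rfl⟩
  have htmem : t ∈ Ico 0 T := ⟨ht.1, htT⟩
  have huTc : Continuous (u T) := hu.comp_prodMk_univ hTmem
  have hYT : AEMeasurable (fun ω => x + W T ω - W t ω) P :=
    ((hW.aemeasurable T hTmem).const_add x).sub (hW.aemeasurable t ht)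
  have hI1 : Integrable (fun ω => u T (x + W T ω - W t ω)) P :=
    Integrable.of_bound (huTc.measurable.comp_aemeasurable hYT).aestronglyMeasurable C
      (ae_of_all _ fun ω => hC T hTmem _)
  have hIp := hW.integrable_comp_prod hT.le hh ht x (hh_int t htmem x)
  have hI2 : Integrable (fun ω => ∫ s in t..T, h s (x + W s ω - W t ω)) P := by
    simp_rw [intervalIntegral.integral_of_le htT.le, ← integral_Icc_eq_integral_Ioc]
    exact hIp.integral_prod_right
  refine ⟨hI1.add hI2, ?_⟩
  rw [integral_add hI1 hI2]
  have hswap : ∫ ω, (∫ s in t..T, h s (x + W s ω - W t ω)) ∂P =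
      ∫ p, h p.1 (x + W p.1 p.2 - W t p.2) ∂(volume.restrict (Icc t T)).prod P := by
    simp_rw [intervalIntegral.integral_of_le htT.le, ← integral_Icc_eq_integral_Ioc]
    exact (integral_prod_symm _ hIp).symm
  rw [hswap]
  obtain ⟨φ, K, hφ⟩ := exists_cutoff_sequence (E := EuclideanSpace ℝ (Fin d))
  have hφlim : ∀ y, ∀ᶠ n in atTop, φ n y = 1 := fun y => by
    filter_upwards [eventually_ge_atTop ⌈‖y‖⌉₊] with n hn
    exact (hφ n).2.2.2.1 y (Nat.ceil_le.1 hn)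
  have hlim : ∀ (y : EuclideanSpace ℝ (Fin d)) (a : ℝ),
      Tendsto (fun n => φ n y * a) atTop (𝓝 a) := fun y a =>
    tendsto_const_nhds.congr' ((hφlim y).mono fun n hn => by simp [hn])
  -- the terminal term
  have hA : Tendsto (fun n => ∫ ω, φ n (x + W T ω - W t ω) * u T (x + W T ω - W t ω) ∂P) atTop
      (𝓝 (∫ ω, u T (x + W T ω - W t ω) ∂P)) := by
    refine tendsto_integral_of_dominated_convergence (fun _ => C) (fun n => ?_)
      (integrable_const C) (fun n => ae_of_all _ fun ω => ?_) (ae_of_all _ fun ω => hlim _ _)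
    · exact (((hφ n).1.continuous.mul huTc).measurable.comp_aemeasurable hYT).aestronglyMeasurable
    · rw [norm_mul]
      exact (mul_le_of_le_one_left (norm_nonneg _) ((hφ n).2.2.1 _)).trans (hC T hTmem _)
  -- the source term
  have hmeas : ∀ n, AEStronglyMeasurable (fun p : ℝ × Ω => φ n (x + W p.1 p.2 - W t p.2) *
      h p.1 (x + W p.1 p.2 - W t p.2)) ((volume.restrict (Icc t T)).prod P) := fun n =>
    hW.aestronglyMeasurable_comp hT.le (h := fun s y => φ n y * h s y)
      (((hφ n).1.continuous.comp continuous_snd).continuousOn.mul hh) ht x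
  have hdom : ∀ n, ∀ p : ℝ × Ω, ‖φ n (x + W p.1 p.2 - W t p.2) *
      h p.1 (x + W p.1 p.2 - W t p.2)‖ ≤ ‖h p.1 (x + W p.1 p.2 - W t p.2)‖ := fun n p => by
    rw [norm_mul]
    exact mul_le_of_le_one_left (norm_nonneg _) ((hφ n).2.2.1 _)
  have hB : Tendsto (fun n => ∫ p, φ n (x + W p.1 p.2 - W t p.2) *
      h p.1 (x + W p.1 p.2 - W t p.2) ∂(volume.restrict (Icc t T)).prod P) atTop
      (𝓝 (∫ p, h p.1 (x + W p.1 p.2 - W t p.2) ∂(volume.restrict (Icc t T)).prod P)) :=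
    tendsto_integral_of_dominated_convergence _ hmeas hIp.norm
      (fun n => ae_of_all _ (hdom n)) (ae_of_all _ fun p => hlim _ _)
  set M : ℝ := ∫ z, ‖z‖ ∂stdGaussian (EuclideanSpace ℝ (Fin d)) with hM
  -- The cutoff estimate carried over to `P`: only the laws of single increments enter, and Fubini
  -- fixes `s` before the law of `W s - W t` is used.
  have hest : ∀ n : ℕ, |∫ ω, φ n (x + W T ω - W t ω) * u T (x + W T ω - W t ω) ∂P
      - φ n x * u t x + ∫ p, φ n (x + W p.1 p.2 - W t p.2) *
        h p.1 (x + W p.1 p.2 - W t p.2) ∂(volume.restrict (Icc t T)).prod P| ≤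
      √(T - t) * (C * (K / (n + 1)) * (2 * M + √(T - t))) := fun n => by
    obtain ⟨h1, h2, -, -, h3, h4⟩ := hφ n
    have key := hu_C12.abs_duhamel_cutoff_le hT hu hh hC hpde h1 h2 h3 h4 htmem x
    have e1 := hW.integral_comp ht.1 htT.le le_rfl (g := fun y => φ n y * u T y)
      (h1.continuous.mul huTc) x
    have e2 : ∫ p, φ n (x + W p.1 p.2 - W t p.2) *
        h p.1 (x + W p.1 p.2 - W t p.2) ∂(volume.restrict (Icc t T)).prod P =
        ∫ s in t..T, ∫ z, φ n (x + √(s - t) • z) * h s (x + √(s - t) • z) ∂stdGaussian _ := by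
      rw [integral_prod _ (hIp.mono (hmeas n) (ae_of_all _ (hdom n))),
        intervalIntegral.integral_of_le htT.le, ← integral_Icc_eq_integral_Ioc]
      refine setIntegral_congr_fun measurableSet_Icc fun s hs => ?_
      exact hW.integral_comp ht.1 hs.1 hs.2 (g := fun y => φ n y * h s y)
        (h1.continuous.mul (hh.comp_prodMk_univ ⟨ht.1.trans hs.1, hs.2⟩)) x
    rw [e1, e2]
    exact key
  have hzero : Tendsto (fun n : ℕ => √(T - t) * (C * (K / ((n : ℝ) + 1)) * (2 * M + √(T - t))))
      atTop (𝓝 0) := by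
    have h1 : Tendsto (fun n : ℕ => K / ((n : ℝ) + 1)) atTop (𝓝 0) :=
      tendsto_const_nhds.div_atTop (tendsto_atTop_add_const_right _ _ tendsto_natCast_atTop_atTop)
    simpa using ((h1.const_mul C).mul_const (2 * M + √(T - t))).const_mul (√(T - t))
  have hlim0 := squeeze_zero_norm (fun n => (Real.norm_eq_abs _).trans_le (hest n)) hzero
  have hlim1 := (hA.sub (hlim x (u t x))).add hB
  -- The same sequence tends to the defect in the uncut formula and to zero.
  have := tendsto_nhds_unique hlim1 hlim0
  linarith
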